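/- Let $M$ be a smooth (Hausdorff, finite-dimensional) manifold without boundary and let $\tau:E\to M$ be a smooth real vector bundle of finite rank. A Lie algebroid structure on $E$ consists of a smooth vector bundle morphism $\rho:E\to TM$ over the identity of $M$ (the anchor) and a real Lie bracket $[\cdot,\cdot]$ on the space $\Gamma(E)$ of smooth sections satisfying $[X,fY]=\rho(X)(f)\,Y+f[X,Y]$ for all $X,Y\in\Gamma(E)$ and $f\in C^\infty(M)$; it is regular if $\rho$ has constant rank. The differential $d^E$ is given on smooth functions by $\langle d^Ef,e\rangle=\rho(e)(f)$ and on smooth sections $\theta$ of $E^*$ by $$d^E\theta(X,Y)=\rho(X)(\theta(Y))-\rho(Y)(\theta(X))-\theta([X,Y]),\qquad X,Y\in\Gamma(E).$$ A smooth section $\theta$ of $E^*$ is closed if $d^E\theta=0$, and locally exact if every point of $M$ has an open neighbourhood $U$ with a smooth function $f:U\to\mathbb{R}$ such that $\theta|_U=d^Ef$. Let $(E,[\cdot,\cdot],\rho)$ be a regular Lie algebroid over $M$. A smooth section $\theta$ of $E^*\to M$ is locally exact if and only if it is closed and $\theta(Z)=0$ for every $Z\in\Gamma(\operatorname{Ker}\rho)$,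 that is, for every smooth section $Z$ of $E$ with $\rho(Z)=0$. -/

import Mathlib

open Bundle
open scoped Manifold ContDiff Bundle

noncomputable section

section LieAlgebroids

/-! Throughout, `M` is a smooth manifold without boundary modelled on the finite-dimensional real
vector space `EM`, and `E` is a smooth real vector bundle over `M` with typical fibre `F`.
For a tangent vector `v` at `x`, the number `mvfderiv 𝓘(ℝ, EM) f x v` is the derivative `v(f)`. -/

variable {EM : Type*} [NormedAddCommGroup EM] [NormedSpace ℝ EM]
  {M : Type*} [TopologicalSpace M] [ChartedSpace EM M]
  {F : Type*} [NormedAddCommGroup F] [NormedSpace ℝ F]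
  {E : M → Type*} [TopologicalSpace (TotalSpace F E)] [∀ x, AddCommGroup (E x)]
  [∀ x, Module ℝ (E x)] [∀ x, TopologicalSpace (E x)] [FiberBundle F E] [VectorBundle ℝ F E]

variable (EM F E) in
/-- `Γ(E)`: the smooth sections of the vector bundle `E`. -/
abbrev BundleSection : Type _ := Cₛ^∞⟮𝓘(ℝ, EM); F, E⟯

variable (EM F E) in
/-- `Γ(E*)`: the smooth sections of the dual vector bundle `E*`. -/
abbrev DualSection : Type _ :=
  Cₛ^∞⟮𝓘(ℝ, EM); F →L[ℝ] ℝ, fun x : M => E x →L[ℝ] ℝ⟯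

/-- The product `f X` of a smooth function and a smooth section. -/
def sectionSMul (f : C^∞⟮𝓘(ℝ, EM), M; ℝ⟯) (X : BundleSection EM F E) : BundleSection EM F E :=
  ⟨(f : M → ℝ) • (X : ∀ x, E x), f.contMDiff.smul_section X.contMDiff⟩

variable (EM F E) in
/-- A Lie algebroid structure on the vector bundle `E` over `M`: a morphism of vector bundles
`ρ : E → TM` over the identity of `M` (the anchor) and a real Lie bracket on `Γ(E)` such that
`[X, f Y] = ρ(X)(f) Y + f [X, Y]`. -/
structure LieAlgebroid [IsManifold 𝓘(ℝ, EM) ∞ M] where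
  /-- The anchor, a smooth section of the bundle `Hom(E, TM)`. -/
  anchor : Cₛ^∞⟮𝓘(ℝ, EM); F →L[ℝ] EM,
    fun x : M => E x →L[ℝ] TangentSpace 𝓘(ℝ, EM) x⟯
  /-- The bracket, an `ℝ`-bilinear map. -/
  bracket : BundleSection EM F E →ₗ[ℝ] BundleSection EM F E →ₗ[ℝ] BundleSection EM F E
  bracket_self : ∀ X, bracket X X = 0
  jacobi : ∀ X Y Z, bracket X (bracket Y Z) + bracket Y (bracket Z X)
    + bracket Z (bracket X Y) = 0
  leibniz : ∀ (X Y : BundleSection EM F E) (f : C^∞⟮𝓘(ℝ, EM), M; ℝ⟯) (x : M),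
    bracket X (sectionSMul f Y) x
      = mvfderiv 𝓘(ℝ, EM) f x (anchor x (X x)) • Y x + f x • bracket X Y x

namespace LieAlgebroid

variable [IsManifold 𝓘(ℝ, EM) ∞ M] (A : LieAlgebroid EM F E)

/-- The function `ρ(X)(f)`. -/
def anchorDeriv (X : BundleSection EM F E) (f : M → ℝ) (x : M) : ℝ :=
  mvfderiv 𝓘(ℝ, EM) f x (A.anchor x (X x))

/-- The Lie algebroid is regular: its anchor has constant rank. -/
def IsRegular : Prop :=
  ∃ q : ℕ, ∀ x : M, Module.finrank ℝ (A.anchor x).range = q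

/-- `d^E` on functions: `(d^E f)_x ∈ E*_x` is given by `⟨d^E f, e⟩ = ρ(e)(f)`. -/
def dFun (f : M → ℝ) (x : M) : E x →L[ℝ] ℝ :=
  (mvfderiv 𝓘(ℝ, EM) f x).comp (A.anchor x)

/-- `d^E` on sections of `E*`:
`d^E θ (X, Y) = ρ(X)(θ(Y)) - ρ(Y)(θ(X)) - θ([X, Y])` for `X, Y ∈ Γ(E)`. -/
def dDual (θ : DualSection EM F E) (X Y : BundleSection EM F E) (x : M) : ℝ :=
  A.anchorDeriv X (fun y => θ y (Y y)) x - A.anchorDeriv Y (fun y => θ y (X y)) x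
    - θ x (A.bracket X Y x)

/-- `θ` is closed: `d^E θ = 0`. -/
def IsClosedSection (θ : DualSection EM F E) : Prop :=
  ∀ (X Y : BundleSection EM F E) (x : M), A.dDual θ X Y x = 0

/-- `θ` is locally exact: near every point of `M` there is a smooth function `f` such that
`θ = d^E f`. -/
def IsLocallyExact (θ : DualSection EM F E) : Prop :=
  ∀ x₀ : M, ∃ U : Set M, IsOpen U ∧ x₀ ∈ U ∧ ∃ f : M → ℝ,
    ContMDiffOn 𝓘(ℝ, EM) 𝓘(ℝ, ℝ) ∞ f U ∧ ∀ x ∈ U, θ x = A.dFun f x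

/-- `Z` is a section of `Ker ρ`. -/
def IsKernelSection (Z : BundleSection EM F E) : Prop :=
  ∀ x : M, A.anchor x (Z x) = 0

end LieAlgebroid

end LieAlgebroids

end

/-!
The easy direction is `d^E ∘ d^E = 0`: the anchor intertwines the bracket with the commutator of
derivations (`LieAlgebroid.vectorDeriv_bracket`), which follows from the Jacobi identity for
`X`, `Y`, `f Z` and the Leibniz rule; and `d^E f` visibly vanishes on `Ker ρ`.

For the converse, constancy of the rank makes `Ker ρ` a subbundle, so that `θ` vanishes on every
vector of `Ker ρ` (`LieAlgebroid.IsRegular.exists_kernelSection`) and descends to the image of the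
anchor. In a chart this image is an involutive distribution `D` of constant rank, and a function `f`
with `df = θ` along `D` is needed. Neither the Frobenius theorem nor a Poincaré lemma with
parameters is used; both are replaced by one direct construction.

Write `P` for the fibre of `D` at the base point `y₀` and `pr` for a projection onto `P`. Near `y₀`
the map `pr` identifies the fibres of `D` with `P`; let `C y : P → D y` be the inverse
identification and `α y = θ ∘ C y`. Involutivity of `D` and closedness of `θ` become the symmetry in
`s` and `t` of `DC(C s) t` and `Dα(C s) t` (`fderiv_comm_of_bracket`): the vector fields `C · s`
commute. For `y` near `y₀` put `t = pr (y - y₀)`, follow the curve `u' = -C(u) t`, `u(0) = y`, for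
unit time, back to the transversal `pr = pr y₀`, and set `f(y) = ∫₀¹ α(u) t`
(`exists_primitive_along_commuting`). By the symmetry, the derivative of the curve in the direction
`C(y) s` is `(1 - τ) C(u(τ)) s`, and differentiating under the integral gives `Df(C s) = α s`
because the differentiated integrand is `-d/dτ ((1 - τ) α(u) s)` (`integral_curve_deriv`).

That `u` depends smoothly on `y` is the inverse function theorem in the Banach space of curves
`C([0, 1], V)` (`exists_smooth_solution`): the linearized equation at `y₀` is triangular since
`t = 0` there, and composition with a smooth map is a smooth operator on curves
(`contDiff_curveComp`).
-/

open Set Filter Topology Function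

/-! ### Composition operators on spaces of curves -/

section Curves

open unitInterval

variable {V P Y : Type*} [NormedAddCommGroup V] [NormedSpace ℝ V] [NormedAddCommGroup P]
  [NormedSpace ℝ P] [NormedAddCommGroup Y] [NormedSpace ℝ Y]

/-- A continuous bilinear map `b` applied pointwise to a pair of curves,
`(A, h) ↦ (τ ↦ b (A τ) (h τ))`, as a continuous bilinear map. -/
noncomputable def curveBilin (b : P →L[ℝ] V →L[ℝ] Y) : C(I, P) →L[ℝ] C(I, V) →L[ℝ] C(I, Y) :=
  LinearMap.mkContinuous₂
    (LinearMap.mk₂ ℝ (fun (A : C(I, P)) (h : C(I, V)) =>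
        (⟨fun τ => b (A τ) (h τ), by fun_prop⟩ : C(I, Y)))
      (fun A B h => by ext; simp) (fun c A h => by ext; simp)
      (fun A h k => by ext; simp) (fun c A h => by ext; simp)) ‖b‖
    (fun A h => by
      rw [ContinuousMap.norm_le _ (by positivity)]
      intro τ
      exact (b.le_opNorm₂ _ _).trans (mul_le_mul
        (mul_le_mul_of_nonneg_left (A.norm_coe_le_norm τ) (norm_nonneg b))
        (h.norm_coe_le_norm τ) (norm_nonneg _) (by positivity)))

variable (V) in
/-- The inclusion of the constant curves. -/
noncomputable def constCurve : V →L[ℝ] C(I, V) :=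
  LinearMap.mkContinuous
    { toFun := fun v => ContinuousMap.const I v
      map_add' := fun _ _ => rfl
      map_smul' := fun _ _ => rfl } 1
    (fun v => by
      rw [one_mul, ContinuousMap.norm_le _ (norm_nonneg _)]
      intro τ
      exact le_rfl)

@[simp]
lemma constCurve_apply (v : V) (τ : I) : constCurve V v τ = v := rfl

variable (V) in
/-- The primitive `τ ↦ ∫₀^τ f` of a curve `f` on the unit interval. -/
noncomputable def curvePrimitive : C(I, V) →L[ℝ] C(I, V) :=
  LinearMap.mkContinuous
    { toFun := fun f => ⟨fun τ => ∫ r in (0 : ℝ)..τ, f (projIcc 0 1 zero_le_one r),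
        (intervalIntegral.continuous_primitive (fun a b => Continuous.intervalIntegrable
          (f.continuous.comp continuous_projIcc) a b) 0).comp continuous_subtype_val⟩
      map_add' := fun f g => by
        ext τ
        exact intervalIntegral.integral_add
          ((f.continuous.comp continuous_projIcc).intervalIntegrable _ _)
          ((g.continuous.comp continuous_projIcc).intervalIntegrable _ _)
      map_smul' := fun c f => by
        ext τ
        exact intervalIntegral.integral_smul c _ } 1
    (fun f => by
      rw [one_mul, ContinuousMap.norm_le _ (norm_nonneg _)]
      intro τ
      refine (intervalIntegral.norm_integral_le_of_norm_le_const (C := ‖f‖)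
        fun r _ => f.norm_coe_le_norm _).trans ?_
      rw [sub_zero, abs_of_nonneg τ.2.1]
      exact mul_le_of_le_one_right (norm_nonneg _) τ.2.2)

lemma curvePrimitive_apply (f : C(I, V)) (τ : I) :
    curvePrimitive V f τ = ∫ r in (0 : ℝ)..τ, f (projIcc 0 1 zero_le_one r) := rfl

/-- The composition operator `v ↦ g ∘ v` of a continuous map `g` on curves. -/
def curveComp {g : V → Y} (hg : Continuous g) (v : C(I, V)) : C(I, Y) :=
  (⟨g, hg⟩ : C(V, Y)).comp v

omit [NormedSpace ℝ V] [NormedSpace ℝ Y] in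
lemma continuous_curveComp {g : V → Y} (hg : Continuous g) : Continuous (curveComp hg) :=
  ContinuousMap.continuous_postcomp _

/-- The composition operator of a `C¹` map is differentiable: by the mean value inequality along
the segments from `u τ` to `v τ`, this follows from continuity of the composition operator of the
derivative. The derivative of `g` is given as `b ∘ g'` with `g'` valued in a normed space `P`. -/
lemma hasFDerivAt_curveComp (b : P →L[ℝ] V →L[ℝ] Y) {g : V → Y} {g' : V → P}
    (hg : ∀ x, HasFDerivAt g (b (g' x)) x) (hc : Continuous g) (hc' : Continuous g')
    (u : C(I, V)) :
    HasFDerivAt (curveComp hc) (curveBilin b (curveComp hc' u)) u := by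
  rw [hasFDerivAt_iff_isLittleO, Asymptotics.isLittleO_iff]
  intro ε hε
  have hpos : 0 < ‖b‖ + 1 := by positivity
  obtain ⟨δ, hδ, hball⟩ := Metric.continuousAt_iff.1
    ((continuous_curveComp hc').continuousAt (x := u)) (ε / (‖b‖ + 1)) (div_pos hε hpos)
  filter_upwards [Metric.ball_mem_nhds u hδ] with v hv
  rw [ContinuousMap.norm_le _ (by positivity)]
  intro τ
  have hmv := (convex_segment (u τ) (v τ)).norm_image_sub_le_of_norm_hasFDerivWithin_le'
    (f := g) (f' := fun x => b (g' x)) (φ := b (g' (u τ))) (C := ε)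
    (fun x _ => (hg x).hasFDerivWithinAt) ?_
    (left_mem_segment ℝ _ _) (right_mem_segment ℝ _ _)
  · exact hmv.trans (mul_le_mul_of_nonneg_left ((v - u).norm_coe_le_norm τ) hε.le)
  · intro x hx
    rw [segment_eq_image'] at hx
    obtain ⟨s, hs, rfl⟩ := hx
    have hw : dist (u + s • (v - u)) u < δ := by
      rw [dist_eq_norm, add_sub_cancel_left, norm_smul, Real.norm_of_nonneg hs.1]
      rw [Metric.mem_ball, dist_eq_norm] at hv
      exact (mul_le_of_le_one_left (norm_nonneg _) hs.2).trans_lt hv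
    have h1 := (ContinuousMap.dist_apply_le_dist τ).trans_lt (hball hw)
    rw [dist_eq_norm] at h1
    rw [← map_sub]
    refine (b.le_opNorm _).trans ((mul_le_mul_of_nonneg_left h1.le (norm_nonneg b)).trans ?_)
    rw [mul_div_assoc', div_le_iff₀ hpos]
    nlinarith

set_option synthInstance.maxHeartbeats 200000 in
lemma contDiff_curveComp_succ (b : P →L[ℝ] V →L[ℝ] Y) {g : V → Y} {g' : V → P}
    (hg : ∀ x, HasFDerivAt g (b (g' x)) x) (hc : Continuous g) (hc' : Continuous g') (n : ℕ)
    (h : ContDiff ℝ n (curveComp hc')) : ContDiff ℝ (n + 1) (curveComp hc) := by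
  have hb : ContDiff ℝ n (curveBilin (V := V) b) := by fun_prop
  exact contDiff_succ_iff_hasFDerivAt.2
    ⟨fun u => curveBilin b (curveComp hc' u), hb.comp h, hasFDerivAt_curveComp b hg hc hc'⟩

end Curves

section Curves

universe u v

open unitInterval

/-- Auxiliary form of `contDiff_curveComp`, where the universe of `Y` is closed under passing from
`Y` to `V →L[ℝ] Y`, so that the induction on the order of differentiability is possible. -/
lemma contDiff_curveComp_of_max {V : Type u} {Y : Type max u v} [NormedAddCommGroup V]
    [NormedSpace ℝ V] [NormedAddCommGroup Y] [NormedSpace ℝ Y] {g : V → Y}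
    (hg : ContDiff ℝ ∞ g) (n : ℕ) : ContDiff ℝ n (curveComp hg.continuous) := by
  induction n generalizing Y with
  | zero => exact contDiff_zero.2 (continuous_curveComp _)
  | succ n ih =>
    have hg' : ContDiff ℝ ∞ (fderiv ℝ g) := (contDiff_infty_iff_fderiv.1 hg).2
    exact contDiff_curveComp_succ (ContinuousLinearMap.id ℝ _)
      (fun x => (hg.differentiable (by simp) x).hasFDerivAt) hg.continuous hg'.continuous n
      (ih hg')

/-- The composition operator `v ↦ g ∘ v` on curves is smooth when `g` is. -/
lemma contDiff_curveComp {V : Type u} {Y : Type v} [NormedAddCommGroup V] [NormedSpace ℝ V]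
    [NormedAddCommGroup Y] [NormedSpace ℝ Y] {g : V → Y} (hg : ContDiff ℝ ∞ g) :
    ContDiff ℝ ∞ (curveComp hg.continuous) := by
  rw [contDiff_infty]
  intro n
  have hg' : ContDiff ℝ ∞ (fderiv ℝ g) := (contDiff_infty_iff_fderiv.1 hg).2
  exact (contDiff_curveComp_succ (ContinuousLinearMap.id ℝ _)
    (fun x => (hg.differentiable (by simp) x).hasFDerivAt) hg.continuous hg'.continuous n
    (contDiff_curveComp_of_max.{u, v} hg' n)).of_le (by norm_cast; simp)

end Curves

/-! ### The inverse function theorem -/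

/-- The local inverse of a smooth map with invertible derivative is smooth on a whole
neighbourhood, and the derivative is injective along it. -/
lemma exists_contDiffOn_rightInverse {X Y : Type*} [NormedAddCommGroup X] [NormedSpace ℝ X]
    [CompleteSpace X] [NormedAddCommGroup Y] [NormedSpace ℝ Y] {H : X → Y}
    (hH : ContDiff ℝ ∞ H) {a : X} (e : X ≃L[ℝ] Y) (he : HasFDerivAt H (e : X →L[ℝ] Y) a) :
    ∃ (S : Y → X) (N : Set Y), IsOpen N ∧ H a ∈ N ∧ ContDiffOn ℝ ∞ S N ∧ S (H a) = a ∧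
      ∀ z ∈ N, H (S z) = z ∧ Injective (fderiv ℝ H (S z)) := by
  have hne : (∞ : WithTop ℕ∞) ≠ 0 := by simp
  have hs : HasStrictFDerivAt H (e : X →L[ℝ] Y) a := hH.contDiffAt.hasStrictFDerivAt' he hne
  let φ := hs.toOpenPartialHomeomorph H
  have hφ : ∀ x, φ x = H x := fun x => rfl
  have hO : IsOpen {x : X | fderiv ℝ H x ∈ range ((↑) : (X ≃L[ℝ] Y) → X →L[ℝ] Y)} :=
    (ContinuousLinearEquiv.isOpen).preimage (hH.continuous_fderiv hne)
  have ha : a ∈ φ.source := hs.mem_toOpenPartialHomeomorph_source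
  have hsym : φ.symm (H a) = a := φ.left_inv ha
  refine ⟨φ.symm, φ.target ∩ φ.symm ⁻¹' _, φ.isOpen_inter_preimage_symm hO,
    ⟨φ.map_source ha, ?_⟩, ?_, hsym, ?_⟩
  · rw [mem_preimage, hsym]
    exact ⟨e, he.fderiv.symm⟩
  · rintro z ⟨hz, e', he'⟩
    refine (φ.contDiffAt_symm (f₀' := e') hz ?_ hH.contDiffAt).contDiffWithinAt
    rw [he']
    exact (hH.differentiable hne _).hasFDerivAt
  · rintro z ⟨hz, e', he'⟩
    refine ⟨φ.right_inv hz, ?_⟩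
    rw [← he']
    exact e'.injective

/-! ### Primitives along commuting vector fields -/

section Primitive

open unitInterval

variable {V P Y : Type*} [NormedAddCommGroup V] [NormedSpace ℝ V]
  [NormedAddCommGroup P] [NormedSpace ℝ P] [NormedAddCommGroup Y] [NormedSpace ℝ Y]

/-- For a field of operators `g : V → (P →L Y)` and a projection `pr : V → P`, the map sending a
point `y` and a curve `v` to the curve `τ ↦ g (v τ) (pr (y - y₀))`. -/
noncomputable def curveForm {g : V → P →L[ℝ] Y} (hg : ContDiff ℝ ∞ g) (pr : V →L[ℝ] P) (y₀ : V)
    (p : V × C(I, V)) : C(I, Y) :=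
  curveBilin (ContinuousLinearMap.id ℝ (P →L[ℝ] Y)) (curveComp hg.continuous p.2)
    (constCurve P (pr (p.1 - y₀)))

lemma curveForm_apply {g : V → P →L[ℝ] Y} (hg : ContDiff ℝ ∞ g) (pr : V →L[ℝ] P) (y₀ : V)
    (p : V × C(I, V)) (τ : I) : curveForm hg pr y₀ p τ = g (p.2 τ) (pr (p.1 - y₀)) := rfl

lemma contDiff_curveForm {g : V → P →L[ℝ] Y} (hg : ContDiff ℝ ∞ g) (pr : V →L[ℝ] P) (y₀ : V) :
    ContDiff ℝ ∞ (curveForm hg pr y₀) := by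
  have h1 : ContDiff ℝ ∞ fun p : V × C(I, V) => curveComp hg.continuous p.2 :=
    (contDiff_curveComp hg).comp contDiff_snd
  have h2 : ContDiff ℝ ∞ fun p : V × C(I, V) => constCurve P (pr (p.1 - y₀)) :=
    (constCurve P).contDiff.comp (pr.contDiff.comp (contDiff_fst.sub contDiff_const))
  exact (curveBilin (ContinuousLinearMap.id ℝ (P →L[ℝ] Y))).isBoundedBilinearMap.contDiff.comp
    (h1.prodMk h2)

lemma fderiv_curveForm_apply {g : V → P →L[ℝ] Y} (hg : ContDiff ℝ ∞ g) (pr : V →L[ℝ] P) (y₀ : V)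
    (p q : V × C(I, V)) (τ : I) :
    fderiv ℝ (curveForm hg pr y₀) p q τ
      = fderiv ℝ g (p.2 τ) (q.2 τ) (pr (p.1 - y₀)) + g (p.2 τ) (pr q.1) := by
  have h1 := (ContinuousMap.evalCLM (M := Y) ℝ τ).hasFDerivAt.comp p
    ((contDiff_curveForm hg pr y₀).differentiable (by simp) p).hasFDerivAt
  have h2 : HasFDerivAt (fun p : V × C(I, V) => p.2 τ)
      ((ContinuousMap.evalCLM (M := V) ℝ τ).comp (ContinuousLinearMap.snd ℝ V C(I, V))) p :=
    ((ContinuousMap.evalCLM (M := V) ℝ τ).comp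
      (ContinuousLinearMap.snd ℝ V C(I, V))).hasFDerivAt
  have h3 : HasFDerivAt (fun p : V × C(I, V) => g (p.2 τ)) _ p :=
    (hg.differentiable (by simp) (p.2 τ)).hasFDerivAt.comp p h2
  have h4 : HasFDerivAt (fun p : V × C(I, V) => pr (p.1 - y₀))
      (pr.comp (ContinuousLinearMap.fst ℝ V C(I, V))) p :=
    pr.hasFDerivAt.comp p ((ContinuousLinearMap.fst ℝ V C(I, V)).hasFDerivAt.sub_const y₀)
  have h5 := congrArg (fun L => L q) (h1.unique (h3.clm_apply h4))
  simpa [add_comm] using h5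

/-- Along a curve `u` with `u' = -C(u) t`, a field `g` whose derivatives in the directions
`C · s` and `C · t` are exchangeable satisfies
`d/dτ ((1 - τ) g(u) s) = -((1 - τ) Dg(u)(C(u) s) t + g(u) s)`. This is the integrated form. -/
lemma integral_curve_deriv [CompleteSpace V] [CompleteSpace Y] {C : V → P →L[ℝ] V}
    (hC : ContDiff ℝ ∞ C) {g : V → P →L[ℝ] Y} (hg : ContDiff ℝ ∞ g) {W : Set V}
    (hcomm : ∀ y ∈ W, ∀ s t, fderiv ℝ g y (C y s) t = fderiv ℝ g y (C y t) s)
    (u : C(I, V)) (hu : ∀ τ, u τ ∈ W) (y : V) (t : P)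
    (hode : ∀ τ : I, u τ = y - ∫ r in (0 : ℝ)..τ, C (u (projIcc 0 1 zero_le_one r)) t)
    (s : P) (τ : I) :
    ∫ r in (0 : ℝ)..τ, (fderiv ℝ g (u (projIcc 0 1 zero_le_one r))
        ((1 - (projIcc 0 1 zero_le_one r : ℝ)) • C (u (projIcc 0 1 zero_le_one r)) s) t
      + g (u (projIcc 0 1 zero_le_one r)) s) = g y s - (1 - (τ : ℝ)) • g (u τ) s := by
  have hpc : Continuous (projIcc (0 : ℝ) 1 zero_le_one) := continuous_projIcc
  have hup : Continuous fun r : ℝ => u (projIcc 0 1 zero_le_one r) := u.continuous.comp hpc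
  have hCc : Continuous fun r : ℝ => C (u (projIcc 0 1 zero_le_one r)) :=
    hC.continuous.comp hup
  have hgc : Continuous fun r : ℝ => g (u (projIcc 0 1 zero_le_one r)) :=
    hg.continuous.comp hup
  have hg'c : Continuous fun r : ℝ => fderiv ℝ g (u (projIcc 0 1 zero_le_one r)) :=
    (hg.continuous_fderiv (by simp)).comp hup
  -- the curve `u`, prolonged to a differentiable curve on the whole line
  set v : ℝ → V := fun r => y - ∫ x in (0 : ℝ)..r, C (u (projIcc 0 1 zero_le_one x)) t with hv
  have hvd : ∀ r, HasDerivAt v (-(C (u (projIcc 0 1 zero_le_one r)) t)) r := fun r =>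
    (intervalIntegral.integral_hasDerivAt_right
      ((hCc.clm_apply continuous_const).intervalIntegrable _ _)
      (hCc.clm_apply continuous_const).stronglyMeasurable.stronglyMeasurableAtFilter
      (hCc.clm_apply continuous_const).continuousAt).const_sub y
  have hvu : ∀ r ∈ Icc (0 : ℝ) 1, v r = u (projIcc 0 1 zero_le_one r) := by
    intro r hr
    rw [hode, projIcc_of_mem zero_le_one hr]
  have hF : ∀ r ∈ uIcc (0 : ℝ) τ, HasDerivAt (fun r : ℝ => -((1 - r) • g (v r) s))
      (fderiv ℝ g (u (projIcc 0 1 zero_le_one r))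
        ((1 - (projIcc 0 1 zero_le_one r : ℝ)) • C (u (projIcc 0 1 zero_le_one r)) s) t
      + g (u (projIcc 0 1 zero_le_one r)) s) r := by
    intro r hr
    have hr' : r ∈ Icc (0 : ℝ) 1 := by
      rw [uIcc_of_le τ.2.1] at hr
      exact ⟨hr.1, hr.2.trans τ.2.2⟩
    have h1 : HasDerivAt (fun r => g (v r)) _ r :=
      (hg.differentiable (by simp) (v r)).hasFDerivAt.comp_hasDerivAt r (hvd r)
    have h2 : HasDerivAt (fun r => g (v r) s) _ r := h1.clm_apply (hasDerivAt_const r s)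
    have h3 := (((hasDerivAt_id r).const_sub 1).smul h2).neg
    refine h3.congr_deriv ?_
    rw [hvu r hr', map_smul, smul_apply, hcomm _ (hu _)]
    have : (projIcc 0 1 zero_le_one r : ℝ) = r := by rw [projIcc_of_mem zero_le_one hr']
    simp [this]
    abel
  rw [intervalIntegral.integral_eq_sub_of_hasDerivAt hF]
  · have h0 : v 0 = y := by simp [hv]
    have h1 : v τ = u τ := by rw [hvu _ τ.2, projIcc_val]
    rw [h0, h1]
    simp
    abel
  · apply Continuous.intervalIntegrable
    exact ((hg'c.clm_apply ((continuous_const.sub (continuous_subtype_val.comp hpc)).smul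
      (hCc.clm_apply continuous_const))).clm_apply continuous_const).add
      (hgc.clm_apply continuous_const)

/-- The curves `u = u(y)` solving `u' = -C(u) (pr (y - y₀))`, `u(0) = y`, depend smoothly on `y`
near `y₀`, by the inverse function theorem in the space of curves. The last clause identifies the
derivative of `u` in the direction `h` with any solution `k` of the linearized equation. -/
lemma exists_smooth_solution [CompleteSpace V] {C : V → P →L[ℝ] V} (hC : ContDiff ℝ ∞ C)
    (pr : V →L[ℝ] P) (y₀ : V) :
    ∃ (u : V → C(I, V)) (N : Set V), IsOpen N ∧ y₀ ∈ N ∧ ContDiffOn ℝ ∞ u N ∧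
      u y₀ = constCurve V y₀ ∧
      (∀ y ∈ N, u y = constCurve V y - curvePrimitive V (curveForm hC pr y₀ (y, u y))) ∧
      ∀ y ∈ N, ∀ h k, k = constCurve V h
          - curvePrimitive V (fderiv ℝ (curveForm hC pr y₀) (y, u y) (h, k)) →
        fderiv ℝ u y h = k := by
  have hne : (∞ : WithTop ℕ∞) ≠ 0 := by simp
  have hΨ := contDiff_curveForm hC pr y₀
  let H : V × C(I, V) → V × C(I, V) := fun p =>
    (p.1, p.2 - constCurve V p.1 + curvePrimitive V (curveForm hC pr y₀ p))
  have hH : ContDiff ℝ ∞ H := contDiff_fst.prodMk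
    ((contDiff_snd.sub ((constCurve V).contDiff.comp contDiff_fst)).add
      ((curvePrimitive V).contDiff.comp hΨ))
  have hH' : ∀ p q, fderiv ℝ H p q
      = (q.1, q.2 - constCurve V q.1 + curvePrimitive V (fderiv ℝ (curveForm hC pr y₀) p q)) := by
    intro p q
    have h1 : HasFDerivAt H _ p := hasFDerivAt_fst.prodMk
      ((hasFDerivAt_snd.sub ((constCurve V).hasFDerivAt.comp p hasFDerivAt_fst)).add
        ((curvePrimitive V).hasFDerivAt.comp p (hΨ.differentiable hne p).hasFDerivAt))
    rw [h1.fderiv]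
    rfl
  -- at the constant curve `y₀`, the linearization is triangular
  let a : V × C(I, V) := (y₀, constCurve V y₀)
  let R : V →L[ℝ] C(I, V) := (curvePrimitive V).comp
    ((fderiv ℝ (curveForm hC pr y₀) a).comp (ContinuousLinearMap.inl ℝ V C(I, V))) - constCurve V
  let e : (V × C(I, V)) ≃L[ℝ] (V × C(I, V)) :=
    (ContinuousLinearEquiv.refl ℝ V).skewProd (ContinuousLinearEquiv.refl ℝ C(I, V)) R
  have he : fderiv ℝ H a = (e : V × C(I, V) →L[ℝ] V × C(I, V)) := by
    refine ContinuousLinearMap.ext fun q => ?_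
    rw [hH']
    have : fderiv ℝ (curveForm hC pr y₀) a q = fderiv ℝ (curveForm hC pr y₀) a (q.1, 0) := by
      ext τ
      rw [fderiv_curveForm_apply, fderiv_curveForm_apply]
      simp [a]
    rw [this]
    refine Prod.ext rfl ?_
    change q.2 - constCurve V q.1 + _ = q.2 + (_ - constCurve V q.1)
    abel
  have hHa : H a = (y₀, 0) := by
    have : curveForm hC pr y₀ a = 0 := by
      ext τ
      simp [curveForm_apply, a]
    simp only [H, this, map_zero, add_zero]
    simp [a]
  obtain ⟨S, N, hN, haN, hS, hSa, hSN⟩ := exists_contDiffOn_rightInverse hH e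
    (he ▸ (hH.differentiable hne a).hasFDerivAt)
  rw [hHa] at haN hSa
  have hι : ContDiff ℝ ∞ fun y : V => (y, (0 : C(I, V))) := contDiff_id.prodMk contDiff_const
  have hfst : ∀ y, (y, (0 : C(I, V))) ∈ N → (S (y, 0)).1 = y := fun y hy =>
    congrArg Prod.fst (hSN _ hy).1
  have hS2 : ∀ y, (y, (0 : C(I, V))) ∈ N → S (y, 0) = (y, (S (y, 0)).2) := fun y hy =>
    Prod.ext (hfst y hy) rfl
  refine ⟨fun y => (S (y, 0)).2, (fun y => (y, 0)) ⁻¹' N, hN.preimage hι.continuous, haN,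
    (hS.comp hι.contDiffOn fun y hy => hy).snd, ?_, ?_, ?_⟩
  · simp [hSa, a]
  · intro y hy
    have h1 := congrArg Prod.snd (hSN _ hy).1
    rw [hS2 y hy] at h1
    simp only [H] at h1
    rw [sub_add] at h1
    exact sub_eq_zero.1 h1
  · intro y hy h k hk
    have hSd : HasFDerivAt S (fderiv ℝ S (y, 0)) (y, 0) :=
      ((hS.contDiffAt (hN.mem_nhds hy)).differentiableAt hne).hasFDerivAt
    have h1 : fderiv ℝ H (S (y, 0)) (fderiv ℝ S (y, 0) (h, 0)) = (h, 0) := by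
      have h2 := (hH.differentiable hne (S (y, 0))).hasFDerivAt.comp (y, 0) hSd
      have h3 : H ∘ S =ᶠ[𝓝 (y, 0)] id := by
        filter_upwards [hN.mem_nhds hy] with z hz using (hSN z hz).1
      exact congrArg (fun L => L (h, 0)) (h2.unique ((hasFDerivAt_id _).congr_of_eventuallyEq h3))
    have h4 : fderiv ℝ H (S (y, 0)) (h, k) = (h, 0) := by
      rw [hH', hS2 y hy]
      refine Prod.ext rfl ?_
      change k - constCurve V h + _ = 0
      nth_rewrite 1 [hk]
      abel
    have h5 : fderiv ℝ S (y, 0) (h, 0) = (h, k) := (hSN _ hy).2 (h1.trans h4.symm)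
    have hιd : HasFDerivAt (fun y : V => (y, (0 : C(I, V)))) _ y :=
      (hasFDerivAt_id (𝕜 := ℝ) y).prodMk (hasFDerivAt_const (0 : C(I, V)) y)
    have h6 : HasFDerivAt (𝕜 := ℝ) (fun y : V => S (y, 0)) _ y :=
      HasFDerivAt.comp (g := S) y hSd hιd
    have h7 : HasFDerivAt (𝕜 := ℝ) (fun y : V => (S (y, 0)).2) _ y :=
      (ContinuousLinearMap.snd ℝ V C(I, V)).hasFDerivAt.comp y h6
    rw [h7.fderiv]
    exact congrArg Prod.snd h5

/-- If the vector fields `C · s` commute and the form `α` is closed along them, then `α` has a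
smooth local primitive along them. The primitive at `y` is the integral of `α` along the curve that
flows from `y` back to the transversal `pr = pr y₀`. -/
theorem exists_primitive_along_commuting [CompleteSpace V] {C : V → P →L[ℝ] V}
    (hC : ContDiff ℝ ∞ C) {α : V → P →L[ℝ] ℝ} (hα : ContDiff ℝ ∞ α) (pr : V →L[ℝ] P) {y₀ : V}
    {W : Set V} (hW : W ∈ 𝓝 y₀) (hpr : ∀ y ∈ W, ∀ s, pr (C y s) = s)
    (hcC : ∀ y ∈ W, ∀ s t, fderiv ℝ C y (C y s) t = fderiv ℝ C y (C y t) s)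
    (hcα : ∀ y ∈ W, ∀ s t, fderiv ℝ α y (C y s) t = fderiv ℝ α y (C y t) s) :
    ∃ (f : V → ℝ) (U : Set V), IsOpen U ∧ y₀ ∈ U ∧ ContDiffOn ℝ ∞ f U ∧
      ∀ y ∈ U, ∀ s, fderiv ℝ f y (C y s) = α y s := by
  have hne : (∞ : WithTop ℕ∞) ≠ 0 := by simp
  obtain ⟨u, N, hN, hyN, hu, hu0, hode, hlin⟩ := exists_smooth_solution hC pr y₀
  obtain ⟨ε, hε, hball⟩ := Metric.mem_nhds_iff.1 hW
  have hF := contDiff_curveForm hα pr y₀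
  -- the integral of a curve of reals over the unit interval
  let J : C(I, ℝ) →L[ℝ] ℝ := (ContinuousMap.evalCLM (M := ℝ) ℝ (1 : I)).comp (curvePrimitive ℝ)
  have hmem : ∀ y ∈ N ∩ u ⁻¹' Metric.ball (u y₀) ε, ∀ τ, u y τ ∈ W := by
    rintro y ⟨-, hy⟩ τ
    refine hball (Metric.mem_ball.2 ((ContinuousMap.dist_apply_le_dist (g := u y₀) τ).trans_lt ?_
      |> fun h => by simpa [hu0] using h))
    exact hy
  have hpair : ContDiffOn ℝ ∞ (fun y => (y, u y)) N := contDiffOn_id.prodMk hu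
  refine ⟨fun y => J (curveForm hα pr y₀ (y, u y)), N ∩ u ⁻¹' Metric.ball (u y₀) ε,
    hu.continuousOn.isOpen_inter_preimage hN Metric.isOpen_ball,
    ⟨hyN, Metric.mem_ball_self hε⟩, ?_, ?_⟩
  · exact (J.contDiff.comp_contDiffOn (hF.comp_contDiffOn hpair)).mono inter_subset_left
  · intro y hy s
    have hyW : y ∈ W := by
      have h0 := hmem y hy 0
      rw [hode y hy.1] at h0
      simpa [curvePrimitive_apply] using h0
    have hode' : ∀ τ : I, u y τ
        = y - ∫ r in (0 : ℝ)..τ, C (u y (projIcc 0 1 zero_le_one r)) (pr (y - y₀)) := fun τ => by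
      nth_rewrite 1 [hode y hy.1]
      rfl
    -- the derivative of `u` in the direction `C y s`
    let k : C(I, V) := ⟨fun τ => (1 - (τ : ℝ)) • C (u y τ) s, by
      have := hC.continuous
      fun_prop⟩
    have hk : fderiv ℝ u y (C y s) = k := by
      refine hlin y hy.1 _ _ ?_
      ext τ
      change (1 - (τ : ℝ)) • C (u y τ) s = C y s - curvePrimitive V _ τ
      rw [eq_sub_iff_add_eq, ← eq_sub_iff_add_eq', ← integral_curve_deriv hC hC hcC (u y)
        (hmem y hy) y (pr (y - y₀)) hode' s τ, curvePrimitive_apply]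
      refine intervalIntegral.integral_congr fun r _ => ?_
      simp only [fderiv_curveForm_apply, hpr y hyW]
      rfl
    have hud : HasFDerivAt (fun y => (y, u y)) _ y := (hasFDerivAt_id y).prodMk
      ((hu.contDiffAt (hN.mem_nhds hy.1)).differentiableAt hne).hasFDerivAt
    have hfd' : HasFDerivAt (fun y => curveForm hα pr y₀ (y, u y)) _ y :=
      HasFDerivAt.comp (g := curveForm hα pr y₀) y
        (hF.differentiable hne (y, u y)).hasFDerivAt hud
    have hfd : HasFDerivAt (fun y => J (curveForm hα pr y₀ (y, u y))) _ y :=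
      J.hasFDerivAt.comp y hfd'
    rw [hfd.fderiv]
    change curvePrimitive ℝ (fderiv ℝ (curveForm hα pr y₀) (y, u y)
      (C y s, fderiv ℝ u y (C y s))) 1 = α y s
    rw [hk, curvePrimitive_apply]
    have h1 := integral_curve_deriv hC hα hcα (u y) (hmem y hy) y (pr (y - y₀)) hode' s 1
    rw [Icc.coe_one, sub_self, zero_smul, sub_zero] at h1
    rw [← h1]
    refine intervalIntegral.integral_congr fun r _ => ?_
    simp only [fderiv_curveForm_apply, hpr y hyW]
    rfl

end Primitive

/-! ### Involutive families of vector fields on a vector space -/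

section Involutive

variable {V P Y : Type*} [NormedAddCommGroup V] [NormedSpace ℝ V]
  [NormedAddCommGroup P] [NormedSpace ℝ P] [NormedAddCommGroup Y] [NormedSpace ℝ Y]

/-- A map that is smooth on an open set has the same germ at any point of it as some map that is
smooth everywhere. -/
lemma exists_contDiff_eventuallyEq [FiniteDimensional ℝ V] {g : V → Y} {U : Set V}
    (hU : IsOpen U) (hg : ContDiffOn ℝ ∞ g U) {y₀ : V} (hy₀ : y₀ ∈ U) :
    ∃ g' : V → Y, ContDiff ℝ ∞ g' ∧ g' =ᶠ[𝓝 y₀] g := by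
  obtain ⟨ε, hε, hball⟩ := Metric.isOpen_iff.1 hU y₀ hy₀
  let ψ : ContDiffBump y₀ := ⟨ε / 3, ε / 2, by positivity, by linarith⟩
  refine ⟨fun y => ψ y • g y, contDiff_iff_contDiffAt.2 fun z => ?_, ?_⟩
  · by_cases hz : z ∈ U
    · exact ψ.contDiff.contDiffAt.smul (hg.contDiffAt (hU.mem_nhds hz))
    · have hz' : z ∉ tsupport ψ := by
        rw [ψ.tsupport_eq]
        exact fun h => hz (hball (Metric.closedBall_subset_ball (by simp only [ψ]; linarith) h))
      refine (contDiffAt_const (c := (0 : Y))).congr_of_eventuallyEq ?_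
      filter_upwards [notMem_tsupport_iff_eventuallyEq.1 hz'] with y hy
      rw [hy]
      simp
  · filter_upwards [ψ.eventuallyEq_one] with y hy
    rw [hy]
    simp

/-- If `C · s` and `C · t` are values of fields from an involutive family whose members satisfy
`w i = g · (pr (v i))`, then the derivatives of `g` along them are exchangeable. -/
lemma fderiv_comm_of_bracket {ι : Type*} {v : ι → V → V} {w : ι → V → Y} {g : V → P →L[ℝ] Y}
    {pr : V →L[ℝ] P} {y : V} {i j k : ι} (hg : DifferentiableAt ℝ g y)
    (hv : ∀ i, DifferentiableAt ℝ (v i) y) (hw : ∀ i, w i =ᶠ[𝓝 y] fun z => g z (pr (v i z)))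
    (hbv : fderiv ℝ (v j) y (v i y) - fderiv ℝ (v i) y (v j y) = v k y)
    (hbw : fderiv ℝ (w j) y (v i y) - fderiv ℝ (w i) y (v j y) = w k y) :
    fderiv ℝ g y (v i y) (pr (v j y)) = fderiv ℝ g y (v j y) (pr (v i y)) := by
  have h : ∀ i h, fderiv ℝ (w i) y h
      = fderiv ℝ g y h (pr (v i y)) + g y (pr (fderiv ℝ (v i) y h)) := by
    intro i h
    have h1 : HasFDerivAt (fun z => g z (pr (v i z))) _ y :=
      hg.hasFDerivAt.clm_apply (pr.hasFDerivAt.comp y (hv i).hasFDerivAt)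
    rw [(hw i).fderiv_eq, h1.fderiv]
    simp [add_comm]
  have hk : w k y = g y (pr (v k y)) := (hw k).self_of_nhds
  rw [h, h, hk, ← hbv, map_sub, map_sub] at hbw
  rw [← sub_eq_zero]
  rw [← sub_eq_zero] at hbw
  rw [← hbw]
  abel

/-- Vector fields whose values at each point form a subspace `D y` of constant dimension admit a
local frame: near `y₀`, finitely many of them span all the others. The projection `pr` onto `D y₀`
identifies `D y` with `D y₀` near `y₀`, and `s ↦ ∑ j, c j (R y s) • v (idx j) y` is the inverse
identification. -/
lemma exists_frame_of_finrank_eq [FiniteDimensional ℝ V] {ι : Type*} {v : ι → V → V}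
    {T : Set V} (hT : IsOpen T) {y₀ : V} (hy₀ : y₀ ∈ T) (hv : ∀ i, ContDiffOn ℝ ∞ (v i) T) {q : ℕ}
    {D : V → Submodule ℝ V} (hD : ∀ y ∈ T, Module.finrank ℝ (D y) = q)
    (hDv : ∀ y ∈ T, (D y : Set V) = range (fun i => v i y)) :
    ∃ (n : ℕ) (idx : Fin n → ι) (c : Fin n → D y₀ →L[ℝ] ℝ) (pr : V →L[ℝ] D y₀)
      (R : V → D y₀ →L[ℝ] D y₀) (U : Set V), IsOpen U ∧ y₀ ∈ U ∧ U ⊆ T ∧ ContDiffOn ℝ ∞ R U ∧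
      (∀ y ∈ U, ∀ s, pr (∑ j, c j (R y s) • v (idx j) y) = s) ∧
      ∀ y ∈ U, ∀ i, ∑ j, c j (R y (pr (v i y))) • v (idx j) y = v i y := by
  have hvD : ∀ y ∈ T, ∀ i, v i y ∈ D y := fun y hy i => by
    rw [← SetLike.mem_coe, hDv y hy]
    exact mem_range_self i
  have hDex : ∀ y ∈ T, ∀ d ∈ D y, ∃ i, v i y = d := fun y hy d hd => by
    rwa [← SetLike.mem_coe, hDv y hy] at hd
  obtain ⟨pr₀, hpr₀⟩ := (D y₀).subtype.exists_leftInverse_of_injective (Submodule.ker_subtype _)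
  let pr : V →L[ℝ] D y₀ := pr₀.toContinuousLinearMap
  have hpr : ∀ s : D y₀, pr s = s := fun s => congrArg (fun L => L s) hpr₀
  let b := Module.finBasis ℝ (D y₀)
  choose idx hidx using fun j => hDex y₀ hy₀ (b j) (b j).2
  let c : ∀ j, D y₀ →L[ℝ] ℝ := fun j => (b.coord j).toContinuousLinearMap
  let L : V → D y₀ →L[ℝ] V := fun y => ∑ j, (c j).smulRight (v (idx j) y)
  have hLs : ∀ y s, ∑ j, c j s • v (idx j) y = L y s := fun y s => by
    simp only [L, sum_apply, ContinuousLinearMap.smulRight_apply]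
  have hL : ContDiffOn ℝ ∞ L T := ContDiffOn.sum fun j _ =>
    contDiffOn_const.smulRight (hv (idx j))
  have hLD : ∀ y ∈ T, ∀ s, L y s ∈ D y := fun y hy s => by
    rw [← hLs]
    exact Submodule.sum_mem _ fun j _ => Submodule.smul_mem _ _ (hvD y hy _)
  let Q : V → D y₀ →L[ℝ] D y₀ := fun y => pr.comp (L y)
  have hQ : ContDiffOn ℝ ∞ Q T := contDiffOn_const.clm_comp hL
  have hQ₀ : Q y₀ = ContinuousLinearEquiv.refl ℝ (D y₀) := by
    ext1 s
    have : L y₀ s = s := by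
      have h1 := congrArg (Submodule.subtype (D y₀)) (b.sum_repr s)
      rw [map_sum] at h1
      rw [← hLs]
      simp only [hidx]
      exact h1
    change pr (L y₀ s) = s
    rw [this, hpr]
  refine ⟨_, idx, c, pr, fun y => (Q y).inverse,
    T ∩ Q ⁻¹' range ((↑) : (D y₀ ≃L[ℝ] D y₀) → D y₀ →L[ℝ] D y₀),
    hQ.continuousOn.isOpen_inter_preimage hT ContinuousLinearEquiv.isOpen,
    ⟨hy₀, ContinuousLinearEquiv.refl ℝ (D y₀), hQ₀.symm⟩, inter_subset_left, ?_, ?_, ?_⟩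
  · rintro y ⟨hy, e, he⟩
    have h1 : ContDiffAt ℝ ∞ ContinuousLinearMap.inverse (Q y) := he ▸ contDiffAt_map_inverse e
    exact h1.comp_contDiffWithinAt y ((hQ y hy).mono inter_subset_left)
  · rintro y ⟨hy, e, he⟩ s
    rw [hLs]
    change Q y ((Q y).inverse s) = s
    rw [← he]
    simp
  · rintro y ⟨hy, e, he⟩ i
    have hinj : Injective (L y) := by
      have : Injective (Q y) := by rw [← he]; exact e.injective
      exact Injective.of_comp this
    have hrange : LinearMap.range (L y : D y₀ →ₗ[ℝ] V) = D y := by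
      refine Submodule.eq_of_le_of_finrank_eq ?_ ?_
      · rintro _ ⟨s, rfl⟩
        exact hLD y hy s
      · rw [LinearMap.finrank_range_of_inj hinj, hD y hy, hD y₀ hy₀]
    obtain ⟨s, hs⟩ : v i y ∈ LinearMap.range (L y : D y₀ →ₗ[ℝ] V) := hrange ▸ hvD y hy i
    have hs' : L y s = v i y := hs
    have hinv : (Q y).inverse (pr (v i y)) = s := by
      rw [← hs']
      change (Q y).inverse (Q y s) = s
      rw [← he]
      simp
    rw [hLs, hinv, hs']

/-- Let the values of the vector fields `v i` at each point form a subspace of constant dimension,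
and let `a i y` be the value on `v i y` of a linear form. If the pairs `(v i, a i)` are stable under
`(v, a), (w, b) ↦ ([v, w], v(b) - w(a))`, that is, the fields are involutive and the forms are
closed along them, then the forms have a local primitive along the fields. -/
theorem exists_primitive_of_involutive [FiniteDimensional ℝ V] {ι : Type*} {v : ι → V → V}
    {a : ι → V → ℝ} {T : Set V} (hT : IsOpen T) {y₀ : V} (hy₀ : y₀ ∈ T)
    (hv : ∀ i, ContDiffOn ℝ ∞ (v i) T) (ha : ∀ i, ContDiffOn ℝ ∞ (a i) T) (q : ℕ)
    (hrank : ∀ y ∈ T, ∃ (D : Submodule ℝ V) (l : V →ₗ[ℝ] ℝ), Module.finrank ℝ D = q ∧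
      (D : Set V) = range (fun i => v i y) ∧ ∀ i, a i y = l (v i y))
    (hbr : ∀ i j, ∃ k, ∀ y ∈ T,
      fderiv ℝ (v j) y (v i y) - fderiv ℝ (v i) y (v j y) = v k y ∧
      fderiv ℝ (a j) y (v i y) - fderiv ℝ (a i) y (v j y) = a k y) :
    ∃ (f : V → ℝ) (U : Set V), IsOpen U ∧ y₀ ∈ U ∧ U ⊆ T ∧ ContDiffOn ℝ ∞ f U ∧
      ∀ y ∈ U, ∀ i, fderiv ℝ f y (v i y) = a i y := by
  choose! D l hD hDv hl using hrank
  have hDex : ∀ y ∈ T, ∀ d ∈ D y, ∃ i, v i y = d := fun y hy d hd => by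
    rwa [← SetLike.mem_coe, hDv y hy] at hd
  obtain ⟨n, idx, c, pr, R, U, hU, hyU, hUT, hR, hprR, hRv⟩ :=
    exists_frame_of_finrank_eq hT hy₀ hv hD hDv
  -- fields and forms as operators on `D y₀`, expressed in the frame
  let C : V → D y₀ →L[ℝ] V := fun y => (∑ j, (c j).smulRight (v (idx j) y)).comp (R y)
  let α : V → D y₀ →L[ℝ] ℝ := fun y => (∑ j, (c j).smulRight (a (idx j) y)).comp (R y)
  have hC : ContDiffOn ℝ ∞ C U := ((ContDiffOn.sum fun j _ =>
    contDiffOn_const.smulRight (hv (idx j))).mono hUT).clm_comp hR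
  have hα : ContDiffOn ℝ ∞ α U := ((ContDiffOn.sum fun j _ =>
    contDiffOn_const.smulRight (ha (idx j))).mono hUT).clm_comp hR
  have hCs : ∀ y s, C y s = ∑ j, c j (R y s) • v (idx j) y := fun y s => by
    simp only [C, ContinuousLinearMap.comp_apply, sum_apply, ContinuousLinearMap.smulRight_apply]
  have hαs : ∀ y ∈ U, ∀ s, α y s = l y (C y s) := fun y hy s => by
    rw [hCs, map_sum]
    simp only [α, ContinuousLinearMap.comp_apply, sum_apply, ContinuousLinearMap.smulRight_apply,
      map_smul, hl y (hUT hy)]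
  have hprC : ∀ y ∈ U, ∀ s, pr (C y s) = s := fun y hy s => by rw [hCs, hprR y hy]
  have hCv : ∀ y ∈ U, ∀ i, C y (pr (v i y)) = v i y ∧ α y (pr (v i y)) = a i y := by
    intro y hy i
    have h1 : C y (pr (v i y)) = v i y := by rw [hCs, hRv y hy]
    exact ⟨h1, by rw [hαs y hy, h1, hl y (hUT hy)]⟩
  have hCD : ∀ y ∈ U, ∀ s, C y s ∈ D y := fun y hy s => by
    rw [hCs]
    refine Submodule.sum_mem _ fun j _ => Submodule.smul_mem _ _ ?_
    rw [← SetLike.mem_coe, hDv y (hUT hy)]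
    exact mem_range_self _
  have hval : ∀ y ∈ U, ∀ s, ∃ i, v i y = C y s ∧ pr (v i y) = s := by
    intro y hy s
    obtain ⟨i, hi⟩ := hDex y (hUT hy) (C y s) (hCD y hy s)
    exact ⟨i, hi, by rw [hi, hprC y hy]⟩
  have hvd : ∀ y ∈ U, ∀ i, DifferentiableAt ℝ (v i) y := fun y hy i =>
    ((hv i).contDiffAt (hT.mem_nhds (hUT hy))).differentiableAt (by simp)
  have hCcomm : ∀ y ∈ U, ∀ s t, fderiv ℝ C y (C y s) t = fderiv ℝ C y (C y t) s := by
    intro y hy s t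
    obtain ⟨i, hi, his⟩ := hval y hy s
    obtain ⟨j, hj, hjt⟩ := hval y hy t
    obtain ⟨k, hk⟩ := hbr i j
    have := fderiv_comm_of_bracket (w := v)
      ((hC.contDiffAt (hU.mem_nhds hy)).differentiableAt (by simp)) (hvd y hy)
      (fun i => eventually_of_mem (hU.mem_nhds hy) fun z hz => ((hCv z hz i).1).symm)
      (hk y (hUT hy)).1 (hk y (hUT hy)).1
    rwa [his, hjt, hi, hj] at this
  have hαcomm : ∀ y ∈ U, ∀ s t, fderiv ℝ α y (C y s) t = fderiv ℝ α y (C y t) s := by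
    intro y hy s t
    obtain ⟨i, hi, his⟩ := hval y hy s
    obtain ⟨j, hj, hjt⟩ := hval y hy t
    obtain ⟨k, hk⟩ := hbr i j
    have := fderiv_comm_of_bracket (w := a)
      ((hα.contDiffAt (hU.mem_nhds hy)).differentiableAt (by simp)) (hvd y hy)
      (fun i => eventually_of_mem (hU.mem_nhds hy) fun z hz => ((hCv z hz i).2).symm)
      (hk y (hUT hy)).1 (hk y (hUT hy)).2
    rwa [his, hjt, hi, hj] at this
  obtain ⟨C', hC', hCC'⟩ := exists_contDiff_eventuallyEq hU hC hyU
  obtain ⟨α', hα', hαα'⟩ := exists_contDiff_eventuallyEq hU hα hyU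
  obtain ⟨W, hWsub, hW, hyW⟩ := eventually_nhds_iff.1
    ((hCC'.eventuallyEq_nhds.and hαα'.eventuallyEq_nhds).and (hU.eventually_mem hyU))
  obtain ⟨f, U', hU', hyU', hf, hfC⟩ := exists_primitive_along_commuting hC' hα' pr
    (hW.mem_nhds hyW)
    (fun y hy s => by
      obtain ⟨⟨h1, h2⟩, h3⟩ := hWsub y hy
      rw [h1.self_of_nhds, hprC y h3])
    (fun y hy s t => by
      obtain ⟨⟨h1, h2⟩, h3⟩ := hWsub y hy
      rw [h1.fderiv_eq, h1.self_of_nhds, hCcomm y h3])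
    (fun y hy s t => by
      obtain ⟨⟨h1, h2⟩, h3⟩ := hWsub y hy
      rw [h2.fderiv_eq, h1.self_of_nhds, hαcomm y h3])
  refine ⟨f, U' ∩ W, hU'.inter hW, ⟨hyU', hyW⟩, fun y hy => hUT (hWsub y hy.2).2,
    hf.mono inter_subset_left, fun y hy i => ?_⟩
  obtain ⟨⟨h1, h2⟩, h3⟩ := hWsub y hy.2
  have h4 := hfC y hy.1 (pr (v i y))
  rwa [h1.self_of_nhds, h2.self_of_nhds, (hCv y h3 i).1, (hCv y h3 i).2] at h4

end Involutive

/-! ### Smooth sections and functions with prescribed germs -/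

section Sections

variable {EM : Type*} [NormedAddCommGroup EM] [NormedSpace ℝ EM]
  {M : Type*} [TopologicalSpace M] [ChartedSpace EM M]
  {F : Type*} [NormedAddCommGroup F] [NormedSpace ℝ F]
  {E : M → Type*} [TopologicalSpace (TotalSpace F E)] [∀ x, AddCommGroup (E x)]
  [∀ x, Module ℝ (E x)] [∀ x, TopologicalSpace (E x)] [FiberBundle F E] [VectorBundle ℝ F E]
  {G : Type*} [NormedAddCommGroup G] [NormedSpace ℝ G]

@[simp]
lemma sectionSMul_apply (f : C^∞⟮𝓘(ℝ, EM), M; ℝ⟯) (X : BundleSection EM F E) (x : M) :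
    sectionSMul f X x = f x • X x := rfl

variable [FiniteDimensional ℝ EM] [IsManifold 𝓘(ℝ, EM) ∞ M] [T2Space M]

/-- A section that is smooth on an open set `U` becomes, after multiplication by a function
supported in `U`, a global smooth section with the same germ at a given point of `U`. -/
lemma exists_bundleSection_of_contMDiffOn {U : Set M} (hU : IsOpen U) {x : M} (hx : x ∈ U)
    {s : ∀ y, E y} (hs : ContMDiffOn 𝓘(ℝ, EM) (𝓘(ℝ, EM).prod 𝓘(ℝ, F)) ∞
      (fun y => TotalSpace.mk' F y (s y)) U) :
    ∃ (ψ : M → ℝ) (X : BundleSection EM F E), ψ =ᶠ[𝓝 x] 1 ∧ (∀ y ∉ U, ψ y = 0) ∧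
      ∀ y, X y = ψ y • s y := by
  obtain ⟨ψ, -, hψ⟩ := (SmoothBumpFunction.nhds_basis_tsupport (I := 𝓘(ℝ, EM)) x).mem_iff.1
    (hU.mem_nhds hx)
  exact ⟨ψ, ⟨_, ContMDiffOn.smul_section_of_tsupport ψ.contMDiff.contMDiffOn hU hψ hs⟩,
    ψ.eventuallyEq_one, fun y hy => image_eq_zero_of_notMem_tsupport fun h => hy (hψ h),
    fun y => rfl⟩

lemma exists_bundleSection_apply_eq [ContMDiffVectorBundle ∞ F E 𝓘(ℝ, EM)] {x : M} (e : E x) :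
    ∃ X : BundleSection EM F E, X x = e := by
  let t := trivializationAt F E x
  have hx : x ∈ t.baseSet := FiberBundle.mem_baseSet_trivializationAt' x
  have hs : ContMDiffOn 𝓘(ℝ, EM) (𝓘(ℝ, EM).prod 𝓘(ℝ, F)) ∞
      (fun y => TotalSpace.mk' F y (FiberBundle.extend F e y)) t.baseSet := by
    rw [t.contMDiffOn_section_baseSet_iff]
    apply (contMDiffOn_const (c := (t ⟨x, e⟩).2)).congr
    intro y hy
    simp [FiberBundle.extend, t, t.apply_mk_symm hy]
  obtain ⟨ψ, X, hψ, -, hX⟩ := exists_bundleSection_of_contMDiffOn t.open_baseSet hx hs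
  refine ⟨X, ?_⟩
  rw [hX, hψ.self_of_nhds]
  simp

lemma exists_contMDiffMap_eventuallyEq {U : Set M} (hU : IsOpen U) {x : M} (hx : x ∈ U)
    {f : M → ℝ} (hf : ContMDiffOn 𝓘(ℝ, EM) 𝓘(ℝ, ℝ) ∞ f U) :
    ∃ g : C^∞⟮𝓘(ℝ, EM), M; ℝ⟯, g =ᶠ[𝓝 x] f := by
  obtain ⟨ψ, -, hψ⟩ := (SmoothBumpFunction.nhds_basis_tsupport (I := 𝓘(ℝ, EM)) x).mem_iff.1
    (hU.mem_nhds hx)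
  refine ⟨⟨fun y => ψ y * f y, contMDiff_of_tsupport fun y hy => ?_⟩, ?_⟩
  · have hy' : y ∈ U := hψ (tsupport_mul_subset_left hy)
    exact ψ.contMDiffAt.mul (hf.contMDiffAt (hU.mem_nhds hy'))
  · filter_upwards [ψ.eventuallyEq_one] with y hy
    change ψ y * f y = f y
    rw [hy]
    simp

end Sections

/-! ### The anchor and the bracket -/

section Anchor

variable {EM : Type*} [NormedAddCommGroup EM] [NormedSpace ℝ EM]
  {M : Type*} [TopologicalSpace M] [ChartedSpace EM M] [IsManifold 𝓘(ℝ, EM) ∞ M]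
  {F : Type*} [NormedAddCommGroup F] [NormedSpace ℝ F]
  {E : M → Type*} [TopologicalSpace (TotalSpace F E)] [∀ x, AddCommGroup (E x)]
  [∀ x, Module ℝ (E x)] [∀ x, TopologicalSpace (E x)] [FiberBundle F E] [VectorBundle ℝ F E]
  {G : Type*} [NormedAddCommGroup G] [NormedSpace ℝ G]

omit [IsManifold 𝓘(ℝ, EM) ∞ M] in
lemma mvfderiv_clm_comp {f : M → G} {x : M} (hf : MDifferentiableAt 𝓘(ℝ, EM) 𝓘(ℝ, G) f x)
    (l : G →L[ℝ] ℝ) (w : TangentSpace 𝓘(ℝ, EM) x) :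
    mvfderiv 𝓘(ℝ, EM) (fun y => l (f y)) x w = l (mvfderiv 𝓘(ℝ, EM) f x w) := by
  have h := HasMFDerivAt.comp x l.hasFDerivAt.hasMFDerivAt hf.hasMFDerivAt
  exact congrArg (fun L : EM →L[ℝ] ℝ => L w) h.mfderiv

namespace LieAlgebroid

variable (A : LieAlgebroid EM F E)

/-- The function `ρ(X)(g)` for a function `g` with values in a normed space. -/
noncomputable def vectorDeriv (X : BundleSection EM F E) (g : M → G) (x : M) : G :=
  mvfderiv 𝓘(ℝ, EM) g x (A.anchor x (X x))

lemma vectorDeriv_congr (X : BundleSection EM F E) {f g : M → G} {x : M} (h : f =ᶠ[𝓝 x] g) :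
    A.vectorDeriv X f x = A.vectorDeriv X g x :=
  congrArg (fun L : EM →L[ℝ] G => L (A.anchor x (X x))) h.mfderiv_eq

lemma contMDiffOn_vectorDeriv (X : BundleSection EM F E) {g : M → G} {U : Set M} (hU : IsOpen U)
    (hg : ContMDiffOn 𝓘(ℝ, EM) 𝓘(ℝ, G) ∞ g U) :
    ContMDiffOn 𝓘(ℝ, EM) 𝓘(ℝ, G) ∞ (A.vectorDeriv X g) U := by
  have h1 : ContMDiff 𝓘(ℝ, EM) 𝓘(ℝ, EM).tangent ∞
      (fun y => TotalSpace.mk' EM (E := TangentSpace 𝓘(ℝ, EM)) y (A.anchor y (X y))) :=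
    A.anchor.contMDiff.clm_bundle_apply X.contMDiff
  have h2 := hg.contMDiffOn_tangentMapWithin (m := ∞) (by simp) hU.uniqueMDiffOn
  have h3 := (contMDiff_snd_tangentBundle_modelSpace (n := ∞) G 𝓘(ℝ, G)).comp_contMDiffOn
    (h2.comp h1.contMDiffOn fun y hy => hy)
  refine h3.congr fun y hy => ?_
  change mfderiv 𝓘(ℝ, EM) 𝓘(ℝ, G) g y _ = mfderivWithin 𝓘(ℝ, EM) 𝓘(ℝ, G) g U y _
  rw [mfderivWithin_of_isOpen hU hy]

omit [IsManifold 𝓘(ℝ, EM) ∞ M] in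
lemma contMDiff_dual_apply (θ : DualSection EM F E) (X : BundleSection EM F E) :
    ContMDiff 𝓘(ℝ, EM) 𝓘(ℝ, ℝ) ∞ fun y => θ y (X y) := by
  have h := θ.contMDiff.clm_bundle_apply (E₂ := Bundle.Trivial M ℝ) X.contMDiff
  intro y
  exact (contMDiffAt_totalSpace.1 (h y)).2

lemma bracket_swap (X Y : BundleSection EM F E) : A.bracket X Y = -A.bracket Y X := by
  have h := A.bracket_self (X + Y)
  simp only [map_add, LinearMap.add_apply, A.bracket_self, zero_add, add_zero] at h
  exact eq_neg_of_add_eq_zero_right h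

/-- The Leibniz rule, as an identity of sections. -/
lemma bracket_sectionSMul (X Y : BundleSection EM F E) (f g : C^∞⟮𝓘(ℝ, EM), M; ℝ⟯)
    (hg : ∀ x, g x = A.vectorDeriv X f x) :
    A.bracket X (sectionSMul f Y) = sectionSMul g Y + sectionSMul f (A.bracket X Y) := by
  ext x
  rw [A.leibniz]
  change _ = g x • Y x + f x • A.bracket X Y x
  rw [hg]
  rfl

variable [FiniteDimensional ℝ EM] [T2Space M] [ContMDiffVectorBundle ∞ F E 𝓘(ℝ, EM)]

/-- The anchor intertwines the bracket with the commutator of derivations: compare the coefficients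
of `Z` in the Jacobi identity for `X`, `Y`, `f Z`. -/
lemma vectorDeriv_bracket_contMDiffMap (X Y : BundleSection EM F E) (f : C^∞⟮𝓘(ℝ, EM), M; ℝ⟯)
    (x : M) :
    A.vectorDeriv (A.bracket X Y) f x
      = A.vectorDeriv X (A.vectorDeriv Y f) x - A.vectorDeriv Y (A.vectorDeriv X f) x := by
  have hsm : ∀ (X : BundleSection EM F E) (f : C^∞⟮𝓘(ℝ, EM), M; ℝ⟯),
      ContMDiff 𝓘(ℝ, EM) 𝓘(ℝ, ℝ) ∞ (A.vectorDeriv X f) := fun X f =>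
    contMDiffOn_univ.1 (A.contMDiffOn_vectorDeriv X isOpen_univ f.contMDiff.contMDiffOn)
  by_cases hE : ∀ e : E x, e = 0
  · simp [vectorDeriv, hE (X x), hE (Y x), hE (A.bracket X Y x)]
  obtain ⟨e, he⟩ := not_forall.1 hE
  obtain ⟨Z, hZ⟩ := exists_bundleSection_apply_eq (EM := EM) (F := F) e
  let d : BundleSection EM F E → C^∞⟮𝓘(ℝ, EM), M; ℝ⟯ → C^∞⟮𝓘(ℝ, EM), M; ℝ⟯ := fun X f =>
    ⟨A.vectorDeriv X f, hsm X f⟩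
  have hd : ∀ X Y f, A.bracket X (sectionSMul f Y)
      = sectionSMul (d X f) Y + sectionSMul f (A.bracket X Y) := fun X Y f =>
    A.bracket_sectionSMul X Y f (d X f) fun _ => rfl
  have h1 := congrArg (fun s : BundleSection EM F E => s x) (A.jacobi X Y (sectionSMul f Z))
  have h2 := congrArg (fun s : BundleSection EM F E => s x) (A.jacobi X Y Z)
  rw [A.bracket_swap (sectionSMul f Z) X, A.bracket_swap (sectionSMul f Z) (A.bracket X Y)] at h1
  rw [A.bracket_swap Z X, A.bracket_swap Z (A.bracket X Y)] at h2
  simp only [hd, map_add, map_neg] at h1 h2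
  simp only [ContMDiffSection.coe_add, ContMDiffSection.coe_neg, ContMDiffSection.coe_zero,
    Pi.add_apply, Pi.neg_apply, Pi.zero_apply, sectionSMul_apply] at h1 h2
  have h3 : (d X (d Y f) x - d Y (d X f) x - d (A.bracket X Y) f x) • Z x = 0 := by
    linear_combination (norm := module) h1 - f x • h2
  rw [hZ] at h3
  have h4 := (smul_eq_zero.1 h3).resolve_right he
  exact (sub_eq_zero.1 h4).symm

/-- The anchor intertwines the bracket with the commutator of derivations, for functions that are
smooth on an open set. -/
lemma vectorDeriv_bracket (X Y : BundleSection EM F E) {g : M → G} {U : Set M} (hU : IsOpen U)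
    (hg : ContMDiffOn 𝓘(ℝ, EM) 𝓘(ℝ, G) ∞ g U) {x : M} (hx : x ∈ U) :
    A.vectorDeriv (A.bracket X Y) g x
      = A.vectorDeriv X (A.vectorDeriv Y g) x - A.vectorDeriv Y (A.vectorDeriv X g) x := by
  rw [SeparatingDual.eq_iff_forall_dual_eq (R := ℝ)]
  intro l
  have hmd : ∀ (Z : BundleSection EM F E) {h : M → G},
      ContMDiffOn 𝓘(ℝ, EM) 𝓘(ℝ, G) ∞ h U → ∀ y ∈ U,
      A.vectorDeriv Z (fun y => l (h y)) y = l (A.vectorDeriv Z h y) := fun Z h hh y hy =>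
    mvfderiv_clm_comp ((hh.contMDiffAt (hU.mem_nhds hy)).mdifferentiableAt (by simp)) l _
  have hmd2 : ∀ Z W : BundleSection EM F E, l (A.vectorDeriv Z (A.vectorDeriv W g) x)
      = A.vectorDeriv Z (A.vectorDeriv W fun y => l (g y)) x := by
    intro Z W
    rw [← hmd Z (A.contMDiffOn_vectorDeriv W hU hg) x hx]
    refine A.vectorDeriv_congr Z ?_
    filter_upwards [hU.mem_nhds hx] with y hy using (hmd W hg y hy).symm
  have hlg : ContMDiffOn 𝓘(ℝ, EM) 𝓘(ℝ, ℝ) ∞ (fun y => l (g y)) U :=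
    l.contMDiff.comp_contMDiffOn hg
  obtain ⟨f, hf⟩ := exists_contMDiffMap_eventuallyEq hU hx hlg
  have hf1 : ∀ Z : BundleSection EM F E,
      A.vectorDeriv Z f =ᶠ[𝓝 x] A.vectorDeriv Z fun y => l (g y) := fun Z =>
    hf.eventuallyEq_nhds.mono fun y hy =>
      A.vectorDeriv_congr Z hy
  have hf2 : ∀ Z W : BundleSection EM F E, A.vectorDeriv Z (A.vectorDeriv W f) x
      = A.vectorDeriv Z (A.vectorDeriv W fun y => l (g y)) x := fun Z W =>
    A.vectorDeriv_congr Z (hf1 W)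
  rw [map_sub, hmd2, hmd2, ← hmd _ hg x hx, ← hf2, ← hf2, ← (hf1 _).self_of_nhds]
  exact A.vectorDeriv_bracket_contMDiffMap X Y f x

/-- Locally exact sections are closed, because `d^E ∘ d^E = 0`. -/
theorem IsLocallyExact.isClosedSection {A : LieAlgebroid EM F E} {θ : DualSection EM F E}
    (h : A.IsLocallyExact θ) : A.IsClosedSection θ := by
  intro X Y x
  obtain ⟨U, hU, hx, f, hf, hθ⟩ := h x
  have h1 : ∀ Z : BundleSection EM F E, (fun y => θ y (Z y)) =ᶠ[𝓝 x] A.vectorDeriv Z f := by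
    intro Z
    filter_upwards [hU.mem_nhds hx] with y hy
    rw [hθ y hy]
    rfl
  have h2 : ∀ Z W : BundleSection EM F E, A.anchorDeriv W (fun y => θ y (Z y)) x
      = A.vectorDeriv W (A.vectorDeriv Z f) x := fun Z W =>
    A.vectorDeriv_congr W (h1 Z)
  have h3 : θ x (A.bracket X Y x) = A.vectorDeriv (A.bracket X Y) f x := (h1 _).self_of_nhds
  rw [dDual, h2, h2, h3, A.vectorDeriv_bracket X Y hU hf hx, sub_self]

omit [FiniteDimensional ℝ EM] [T2Space M] [ContMDiffVectorBundle ∞ F E 𝓘(ℝ, EM)] in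
theorem IsLocallyExact.apply_eq_zero {A : LieAlgebroid EM F E} {θ : DualSection EM F E}
    (h : A.IsLocallyExact θ) {x : M} {e : E x} (he : A.anchor x e = 0) : θ x e = 0 := by
  obtain ⟨U, -, hx, f, -, hθ⟩ := h x
  rw [hθ x hx]
  change mvfderiv 𝓘(ℝ, EM) f x (A.anchor x e) = 0
  rw [he, map_zero]

end LieAlgebroid

end Anchor

/-! ### The algebroid in a chart -/

section Chart

variable {EM : Type*} [NormedAddCommGroup EM] [NormedSpace ℝ EM]
  {M : Type*} [TopologicalSpace M] [ChartedSpace EM M] [IsManifold 𝓘(ℝ, EM) ∞ M]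
  {F : Type*} [NormedAddCommGroup F] [NormedSpace ℝ F]
  {E : M → Type*} [TopologicalSpace (TotalSpace F E)] [∀ x, AddCommGroup (E x)]
  [∀ x, Module ℝ (E x)] [∀ x, TopologicalSpace (E x)] [FiberBundle F E] [VectorBundle ℝ F E]
  {G : Type*} [NormedAddCommGroup G] [NormedSpace ℝ G]

lemma mvfderiv_comp_extChartAt {x₀ x : M} (hx : x ∈ (extChartAt 𝓘(ℝ, EM) x₀).source) {f : EM → G}
    (hf : DifferentiableAt ℝ f (extChartAt 𝓘(ℝ, EM) x₀ x)) (w : TangentSpace 𝓘(ℝ, EM) x) :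
    mvfderiv 𝓘(ℝ, EM) (fun y => f (extChartAt 𝓘(ℝ, EM) x₀ y)) x w
      = fderiv ℝ f (extChartAt 𝓘(ℝ, EM) x₀ x)
          (mvfderiv 𝓘(ℝ, EM) (extChartAt 𝓘(ℝ, EM) x₀) x w) := by
  have h1 : MDifferentiableAt 𝓘(ℝ, EM) 𝓘(ℝ, EM) (extChartAt 𝓘(ℝ, EM) x₀) x :=
    (contMDiffAt_extChartAt' (n := ∞) (by simpa using hx)).mdifferentiableAt (by simp)
  have h := HasMFDerivAt.comp x hf.hasFDerivAt.hasMFDerivAt h1.hasMFDerivAt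
  exact congrArg (fun L : EM →L[ℝ] G => L w) h.mfderiv

lemma fderiv_comp_extChartAt_symm {x₀ x : M} (hx : x ∈ (extChartAt 𝓘(ℝ, EM) x₀).source)
    {g : M → G} (hg : ContMDiffAt 𝓘(ℝ, EM) 𝓘(ℝ, G) ∞ g x) (w : TangentSpace 𝓘(ℝ, EM) x) :
    fderiv ℝ (fun y => g ((extChartAt 𝓘(ℝ, EM) x₀).symm y)) (extChartAt 𝓘(ℝ, EM) x₀ x)
        (mvfderiv 𝓘(ℝ, EM) (extChartAt 𝓘(ℝ, EM) x₀) x w) = mvfderiv 𝓘(ℝ, EM) g x w := by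
  have h1 : ContMDiffAt 𝓘(ℝ, EM) 𝓘(ℝ, EM) ∞ (extChartAt 𝓘(ℝ, EM) x₀).symm
      (extChartAt 𝓘(ℝ, EM) x₀ x) :=
    (contMDiffOn_extChartAt_symm x₀).contMDiffAt
      ((isOpen_extChartAt_target x₀).mem_nhds (PartialEquiv.map_source _ hx))
  have h2 : ContMDiffAt 𝓘(ℝ, EM) 𝓘(ℝ, G) ∞ (fun y => g ((extChartAt 𝓘(ℝ, EM) x₀).symm y))
      (extChartAt 𝓘(ℝ, EM) x₀ x) :=
    ContMDiffAt.comp (g := g) _ (by rwa [PartialEquiv.left_inv _ hx]) h1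
  rw [← mvfderiv_comp_extChartAt hx (h2.contDiffAt.differentiableAt (by simp))]
  have h3 : (fun y => g ((extChartAt 𝓘(ℝ, EM) x₀).symm (extChartAt 𝓘(ℝ, EM) x₀ y))) =ᶠ[𝓝 x] g := by
    filter_upwards [(isOpen_extChartAt_source x₀).mem_nhds hx] with y hy
    rw [PartialEquiv.left_inv _ hy]
  exact congrArg (fun L : EM →L[ℝ] G => L w) h3.mfderiv_eq

/-- A smooth function on the manifold, read in a chart, is smooth. -/
lemma contDiffOn_comp_extChartAt_symm {x₀ : M} {g : M → G}
    (hg : ContMDiffOn 𝓘(ℝ, EM) 𝓘(ℝ, G) ∞ g (extChartAt 𝓘(ℝ, EM) x₀).source) :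
    ContDiffOn ℝ ∞ (fun y => g ((extChartAt 𝓘(ℝ, EM) x₀).symm y))
      (extChartAt 𝓘(ℝ, EM) x₀).target :=
  (hg.comp (contMDiffOn_extChartAt_symm x₀) fun _ hy => PartialEquiv.map_target _ hy).contDiffOn

lemma contMDiffOn_extChartAt_source (x₀ : M) :
    ContMDiffOn 𝓘(ℝ, EM) 𝓘(ℝ, EM) ∞ (extChartAt 𝓘(ℝ, EM) x₀) (extChartAt 𝓘(ℝ, EM) x₀).source := by
  rw [extChartAt_source]
  exact contMDiffOn_extChartAt

lemma injective_mvfderiv_extChartAt {x₀ x : M} (hx : x ∈ (extChartAt 𝓘(ℝ, EM) x₀).source) :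
    Injective (mvfderiv 𝓘(ℝ, EM) (extChartAt 𝓘(ℝ, EM) x₀) x) := by
  have : IsManifold 𝓘(ℝ, EM) 1 M := .of_le (n := ∞) (by simp)
  obtain ⟨e, he⟩ := isInvertible_mfderiv_extChartAt (I := 𝓘(ℝ, EM)) hx
  have h : Injective (mfderiv 𝓘(ℝ, EM) 𝓘(ℝ, EM) (extChartAt 𝓘(ℝ, EM) x₀) x) := by
    rw [← he]
    exact e.injective
  exact h

namespace LieAlgebroid

variable (A : LieAlgebroid EM F E)

/-- The vector field `ρ(X)` in the chart at `x₀`. -/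
noncomputable def chartField (x₀ : M) (X : BundleSection EM F E) (y : EM) : EM :=
  A.vectorDeriv X (extChartAt 𝓘(ℝ, EM) x₀) ((extChartAt 𝓘(ℝ, EM) x₀).symm y)

/-- The image of the anchor in the chart at `x₀`. -/
noncomputable def chartRange (x₀ : M) (y : EM) : Submodule ℝ EM :=
  (A.anchor ((extChartAt 𝓘(ℝ, EM) x₀).symm y)).range.map
    (mvfderiv 𝓘(ℝ, EM) (extChartAt 𝓘(ℝ, EM) x₀) ((extChartAt 𝓘(ℝ, EM) x₀).symm y)).toLinearMap

lemma contDiffOn_chartField (x₀ : M) (X : BundleSection EM F E) :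
    ContDiffOn ℝ ∞ (A.chartField x₀ X) (extChartAt 𝓘(ℝ, EM) x₀).target :=
  contDiffOn_comp_extChartAt_symm (A.contMDiffOn_vectorDeriv X (isOpen_extChartAt_source x₀)
    (contMDiffOn_extChartAt_source x₀))

lemma fderiv_chartField {x₀ : M} {g : M → G}
    (hg : ContMDiffOn 𝓘(ℝ, EM) 𝓘(ℝ, G) ∞ g (extChartAt 𝓘(ℝ, EM) x₀).source)
    (X : BundleSection EM F E) {y : EM} (hy : y ∈ (extChartAt 𝓘(ℝ, EM) x₀).target) :
    fderiv ℝ (fun y => g ((extChartAt 𝓘(ℝ, EM) x₀).symm y)) y (A.chartField x₀ X y)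
      = A.vectorDeriv X g ((extChartAt 𝓘(ℝ, EM) x₀).symm y) := by
  have hx := PartialEquiv.map_target _ hy
  have h := fderiv_comp_extChartAt_symm hx
    (hg.contMDiffAt ((isOpen_extChartAt_source x₀).mem_nhds hx))
    (A.anchor _ (X ((extChartAt 𝓘(ℝ, EM) x₀).symm y)))
  rwa [PartialEquiv.right_inv _ hy] at h

lemma finrank_chartRange {q : ℕ} (hq : ∀ x : M, Module.finrank ℝ (A.anchor x).range = q) {x₀ : M}
    {y : EM} (hy : y ∈ (extChartAt 𝓘(ℝ, EM) x₀).target) :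
    Module.finrank ℝ (A.chartRange x₀ y) = q := by
  rw [← hq ((extChartAt 𝓘(ℝ, EM) x₀).symm y)]
  exact (Submodule.equivMapOfInjective _
    (injective_mvfderiv_extChartAt (PartialEquiv.map_target _ hy)) _).finrank_eq.symm

variable [FiniteDimensional ℝ EM] [T2Space M] [ContMDiffVectorBundle ∞ F E 𝓘(ℝ, EM)]

lemma coe_chartRange (x₀ : M) (y : EM) :
    (A.chartRange x₀ y : Set EM) = range fun X : BundleSection EM F E => A.chartField x₀ X y := by
  ext w
  constructor
  · rintro ⟨_, ⟨e, rfl⟩, rfl⟩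
    obtain ⟨X, rfl⟩ := exists_bundleSection_apply_eq (EM := EM) (F := F) e
    exact ⟨X, rfl⟩
  · rintro ⟨X, rfl⟩
    exact ⟨_, ⟨_, rfl⟩, rfl⟩

/-- Constancy of the rank makes `Ker ρ` a subbundle: each of its vectors is the value of a global
section of `Ker ρ`. Any section `X` through the vector is corrected by the combination of frame
sections with the same image as `X` under the anchor. -/
theorem IsRegular.exists_kernelSection {A : LieAlgebroid EM F E} (hA : A.IsRegular) {x : M}
    {e : E x} (he : A.anchor x e = 0) :
    ∃ Z : BundleSection EM F E, A.IsKernelSection Z ∧ Z x = e := by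
  obtain ⟨q, hq⟩ := hA
  obtain ⟨X, rfl⟩ := exists_bundleSection_apply_eq (EM := EM) (F := F) e
  obtain ⟨n, idx, c, pr, R, U, hU, hyU, hUT, hR, -, hRv⟩ :=
    exists_frame_of_finrank_eq (isOpen_extChartAt_target x) (mem_extChartAt_target x)
      (A.contDiffOn_chartField x) (fun y hy => A.finrank_chartRange hq hy)
      (fun y _ => A.coe_chartRange x y)
  let φ := extChartAt 𝓘(ℝ, EM) x
  let U' : Set M := φ.source ∩ φ ⁻¹' U
  have hU' : IsOpen U' :=
    (continuousOn_extChartAt x).isOpen_inter_preimage (isOpen_extChartAt_source x) hU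
  have hxU' : x ∈ U' := ⟨mem_extChartAt_source x, hyU⟩
  -- the coefficients of `ρ(X)` in the frame
  let d : Fin n → M → ℝ := fun j y => c j (R (φ y) (pr (A.vectorDeriv X φ y)))
  have hd : ∀ j, ContMDiffOn 𝓘(ℝ, EM) 𝓘(ℝ, ℝ) ∞ (d j) U' := by
    intro j
    have h1 : ContMDiffOn 𝓘(ℝ, EM) 𝓘(ℝ, EM) ∞ φ U' :=
      (contMDiffOn_extChartAt_source x).mono inter_subset_left
    have h2 : ContMDiffOn 𝓘(ℝ, EM) 𝓘(ℝ, EM) ∞ (A.vectorDeriv X φ) U' :=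
      A.contMDiffOn_vectorDeriv X hU' h1
    have h3 := hR.contMDiffOn.comp h1 fun y hy => hy.2
    exact (c j).contMDiff.comp_contMDiffOn
      (h3.clm_apply (pr.contMDiff.comp_contMDiffOn h2))
  have hv : ∀ (Y : BundleSection EM F E), ∀ y ∈ U',
      A.chartField x Y (φ y) = A.vectorDeriv Y φ y := by
    intro Y y hy
    simp only [chartField, φ, PartialEquiv.left_inv _ hy.1]
  let s : ∀ y, E y := fun y => X y - ∑ j, d j y • idx j y
  have hs : ContMDiffOn 𝓘(ℝ, EM) (𝓘(ℝ, EM).prod 𝓘(ℝ, F)) ∞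
      (fun y => TotalSpace.mk' F y (s y)) U' :=
    X.contMDiff.contMDiffOn.sub_section (.sum_section fun j _ =>
      (hd j).smul_section (idx j).contMDiff.contMDiffOn)
  have hρs : ∀ y ∈ U', A.anchor y (s y) = 0 := by
    intro y hy
    apply injective_mvfderiv_extChartAt hy.1
    have h1 := hRv (φ y) hy.2 X
    simp only [hv _ y hy] at h1
    simp only [s, map_sub, map_sum, map_smul, map_zero]
    exact sub_eq_zero.2 h1.symm
  obtain ⟨ψ, Z, hψ, hψU, hZ⟩ := exists_bundleSection_of_contMDiffOn hU' hxU' hs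
  refine ⟨Z, fun y => ?_, ?_⟩
  · rw [hZ, map_smul]
    by_cases hy : y ∈ U'
    · rw [hρs y hy, smul_zero]
    · rw [hψU y hy, zero_smul]
  · have h0 : ∀ j, d j x = 0 := fun j => by
      simp only [d, vectorDeriv, he, map_zero]
    rw [hZ, hψ.self_of_nhds]
    simp [s, h0]

/-- A closed section of `E*` which vanishes on `Ker ρ` is locally exact. -/
theorem IsClosedSection.isLocallyExact {A : LieAlgebroid EM F E} (hA : A.IsRegular)
    {θ : DualSection EM F E} (h : A.IsClosedSection θ)
    (hker : ∀ (x : M) (e : E x), A.anchor x e = 0 → θ x e = 0) : A.IsLocallyExact θ := by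
  intro x₀
  obtain ⟨q, hq⟩ := hA
  let φ := extChartAt 𝓘(ℝ, EM) x₀
  have hθs : ∀ X : BundleSection EM F E,
      ContMDiffOn 𝓘(ℝ, EM) 𝓘(ℝ, ℝ) ∞ (fun x => θ x (X x)) φ.source := fun X =>
    (contMDiff_dual_apply θ X).contMDiffOn
  have hφ : ContMDiffOn 𝓘(ℝ, EM) 𝓘(ℝ, EM) ∞ φ φ.source := contMDiffOn_extChartAt_source x₀
  have hφv : ∀ X : BundleSection EM F E, ContMDiffOn 𝓘(ℝ, EM) 𝓘(ℝ, EM) ∞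
      (A.vectorDeriv X φ) φ.source := fun X =>
    A.contMDiffOn_vectorDeriv X (isOpen_extChartAt_source x₀) hφ
  have hrank : ∀ y ∈ φ.target, ∃ (D : Submodule ℝ EM) (l : EM →ₗ[ℝ] ℝ),
      Module.finrank ℝ D = q ∧ (D : Set EM) = range (fun X => A.chartField x₀ X y) ∧
      ∀ X : BundleSection EM F E, θ (φ.symm y) (X (φ.symm y)) = l (A.chartField x₀ X y) := by
    intro y hy
    have hx : φ.symm y ∈ φ.source := PartialEquiv.map_target _ hy
    -- `θ` at `φ⁻¹ y` factors through the anchor, read in the chart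
    let L : E (φ.symm y) →ₗ[ℝ] EM :=
      (mvfderiv 𝓘(ℝ, EM) φ (φ.symm y)).toLinearMap ∘ₗ (A.anchor (φ.symm y)).toLinearMap
    have hθ : (θ (φ.symm y)).toLinearMap ∈ LinearMap.range L.dualMap := by
      rw [LinearMap.range_dualMap_eq_dualAnnihilator_ker, Submodule.mem_dualAnnihilator]
      intro e he
      refine hker _ e (injective_mvfderiv_extChartAt hx ?_)
      rw [map_zero]
      exact he
    obtain ⟨l, hl⟩ := hθ
    exact ⟨A.chartRange x₀ y, l, A.finrank_chartRange hq hy, A.coe_chartRange x₀ y,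
      fun X => (congrArg (fun L => L (X (φ.symm y))) hl).symm⟩
  have hbr : ∀ X Y : BundleSection EM F E, ∃ Z : BundleSection EM F E, ∀ y ∈ φ.target,
      fderiv ℝ (A.chartField x₀ Y) y (A.chartField x₀ X y)
          - fderiv ℝ (A.chartField x₀ X) y (A.chartField x₀ Y y) = A.chartField x₀ Z y ∧
      fderiv ℝ (fun y => θ (φ.symm y) (Y (φ.symm y))) y (A.chartField x₀ X y)
          - fderiv ℝ (fun y => θ (φ.symm y) (X (φ.symm y))) y (A.chartField x₀ Y y)
        = θ (φ.symm y) (Z (φ.symm y)) := by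
    intro X Y
    refine ⟨A.bracket X Y, fun y hy => ⟨?_, ?_⟩⟩
    · have hx : φ.symm y ∈ φ.source := PartialEquiv.map_target _ hy
      have h1 := A.vectorDeriv_bracket X Y (isOpen_extChartAt_source x₀) hφ hx
      rw [← A.fderiv_chartField (hφv Y) X hy, ← A.fderiv_chartField (hφv X) Y hy] at h1
      exact h1.symm
    · have h1 := h X Y (φ.symm y)
      have h2 : A.vectorDeriv X (fun x => θ x (Y x)) (φ.symm y)
        - A.vectorDeriv Y (fun x => θ x (X x)) (φ.symm y)
        = θ (φ.symm y) (A.bracket X Y (φ.symm y)) := sub_eq_zero.1 h1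
      rw [← A.fderiv_chartField (hθs Y) X hy, ← A.fderiv_chartField (hθs X) Y hy] at h2
      exact h2
  obtain ⟨f, U, hU, hyU, hUT, hf, hfv⟩ := exists_primitive_of_involutive
    (v := A.chartField x₀) (a := fun X y => θ (φ.symm y) (X (φ.symm y)))
    (isOpen_extChartAt_target x₀) (mem_extChartAt_target x₀) (A.contDiffOn_chartField x₀)
    (fun X => contDiffOn_comp_extChartAt_symm (hθs X)) q hrank hbr
  refine ⟨φ.source ∩ φ ⁻¹' U,
    (continuousOn_extChartAt x₀).isOpen_inter_preimage (isOpen_extChartAt_source x₀) hU,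
    ⟨mem_extChartAt_source x₀, hyU⟩, fun x => f (φ x),
    hf.contMDiffOn.comp (hφ.mono inter_subset_left) fun x hx => hx.2, fun x hx => ?_⟩
  ext e
  obtain ⟨X, rfl⟩ := exists_bundleSection_apply_eq (EM := EM) (F := F) e
  have h1 := hfv (φ x) hx.2 X
  have h2 : θ (φ.symm (φ x)) (X (φ.symm (φ x))) = θ x (X x) :=
    congrArg (fun z => θ z (X z)) (PartialEquiv.left_inv _ hx.1)
  rw [h2] at h1
  simp only [chartField, φ, PartialEquiv.left_inv _ hx.1] at h1
  rw [← h1]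
  exact (mvfderiv_comp_extChartAt hx.1
    ((hf.contDiffAt (hU.mem_nhds hx.2)).differentiableAt (by simp)) _).symm

end LieAlgebroid

end Chart

theorem mainTheorem2 {EM : Type*} [NormedAddCommGroup EM] [NormedSpace ℝ EM]
    [FiniteDimensional ℝ EM]
    {M : Type*} [TopologicalSpace M] [ChartedSpace EM M] [IsManifold 𝓘(ℝ, EM) ∞ M]
    [T2Space M]
    {F : Type*} [NormedAddCommGroup F] [NormedSpace ℝ F] [FiniteDimensional ℝ F]
    {E : M → Type*} [TopologicalSpace (TotalSpace F E)] [∀ x, AddCommGroup (E x)]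
    [∀ x, Module ℝ (E x)] [∀ x, TopologicalSpace (E x)] [FiberBundle F E]
    [VectorBundle ℝ F E] [ContMDiffVectorBundle ∞ F E 𝓘(ℝ, EM)]
    (A : LieAlgebroid EM F E) (hA : A.IsRegular) (θ : DualSection EM F E) :
    A.IsLocallyExact θ ↔
      A.IsClosedSection θ ∧
        ∀ Z : BundleSection EM F E, A.IsKernelSection Z → ∀ x : M, θ x (Z x) = 0 := by
  refine ⟨fun h => ⟨h.isClosedSection, fun Z hZ x => h.apply_eq_zero (hZ x)⟩, fun h => ?_⟩
  refine h.1.isLocallyExact hA fun x e he => ?_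
  obtain ⟨Z, hZ, rfl⟩ := hA.exists_kernelSection he
  exact h.2 Z hZ x
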